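/- A permutation of length $n$ is a sequence $\sigma=\sigma_1\ldots\sigma_n$ containing each of $1,\ldots,n$ exactly once. An occurrence of $1324$ in $\sigma$ (as a consecutive pattern) is an index $i$ with $1\le i\le n-3$ such that $\sigma_i\sigma_{i+1}\sigma_{i+2}\sigma_{i+3}$ has the same relative order as $1324$, i.e. $\sigma_i<\sigma_{i+2}<\sigma_{i+1}<\sigma_{i+3}$. Let $\pi_{n,k}$ be the number of permutations of length $n$ with exactly $k$ occurrences of $1324$. For $l\ge1$, an $l$-cluster of length $n$ for $1324$ is a permutation $\sigma$ of length $n$ together with indices $i_1,\ldots,i_l$, each of which is an occurrence of $1324$ in $\sigma$, such that $i_1=1$, $i_l+3=n$, and $i_j<i_{j+1}<i_j+4$ for $1\le j<l$. By convention, the one-element permutation is the only $0$-cluster. Let $c_{n,l}$ be the number of $l$-clusters of length $n$ for $1324$ (and $c_{n,l}=0$ for $l<0$). **Theorem.** The cluster numbers for $1324$ satisfy the initial conditions $c_{1,l}=\delta_{0,l}$, $c_{2,l}=0$, $c_{3,l}=0$ for all $l\ge0$, and, for all $n\ge4$ and $l\ge0$, the recurrence relation $$c_{n,l}=\sum_{4\le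 2k+2\le n}\frac{1}{k+1}\binom{2k}{k}\,c_{n-2k-1,\,l-k}.$$ Moreover, the generating function for occurrences of $1324$ is $$\sum_{n,k\ge0}\pi_{n,k}\frac{x^n}{n!}t^k=\left(1-x-\sum_{n\ge2,\,l\ge1}\frac{c_{n,l}\,x^n(t-1)^l}{n!}\right)^{-1},$$ as formal power series in $x$ with coefficients in $\mathbb{Q}[t]$. -/

import Mathlib

namespace ConsecutivePattern

/-- The permutation `τ` of length `m` is the standardization of the sequence `s` (of `m` distinct
numbers): `s a < s b` if and only if `τ a < τ b`. Positions and values are numbered from `0`. -/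
def IsStandardization {m : ℕ} {α : Type*} [LinearOrder α] (s : Fin m → α)
    (τ : Equiv.Perm (Fin m)) : Prop :=
  ∀ a b : Fin m, s a < s b ↔ τ a < τ b

/-- The pattern `τ` of length `m` occurs (consecutively) in the permutation `σ` of length `n`
at the place `i`: the block `σ i, σ (i + 1), …, σ (i + m - 1)` lies inside `σ` and its
standardization is `τ`. -/
def OccursAt {m n : ℕ} (τ : Equiv.Perm (Fin m)) (σ : Equiv.Perm (Fin n)) (i : Fin n) : Prop :=
  ∃ h : (i : ℕ) + m ≤ n,
    IsStandardization (fun a : Fin m => σ ⟨(i : ℕ) + (a : ℕ), by omega⟩) τ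

/-- The number of occurrences of the pattern `τ` in `σ`. -/
noncomputable def occurrenceCount {m n : ℕ} (τ : Equiv.Perm (Fin m))
    (σ : Equiv.Perm (Fin n)) : ℕ :=
  Set.ncard {i : Fin n | OccursAt τ σ i}

/-- The number of permutations of length `n` with exactly `k` occurrences of `τ`. -/
noncomputable def occurrenceNumber {m : ℕ} (τ : Equiv.Perm (Fin m)) (n k : ℕ) : ℕ :=
  Nat.card {σ : Equiv.Perm (Fin n) // occurrenceCount τ σ = k}

/-- For `q ≥ 1`, the permutation `σ` of length `n` with the `q` marked places `i 0, …, i (q - 1)`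
is a `q`-cluster for the pattern `τ` of length `m`. -/
structure IsCluster {m n q : ℕ} (τ : Equiv.Perm (Fin m)) (σ : Equiv.Perm (Fin n))
    (i : Fin q → Fin n) : Prop where
  /-- every marked place is an occurrence of the pattern -/
  occurs : ∀ k : Fin q, OccursAt τ σ (i k)
  /-- the occurrences are listed from the left to the right -/
  increasing : ∀ k l : Fin q, (k : ℕ) + 1 = l → i k < i l
  /-- adjacent occurrences share at least one entry -/
  linked : ∀ k l : Fin q, (k : ℕ) + 1 = l → (i l : ℕ) < (i k : ℕ) + m
  /-- the first occurrence starts at the beginning of `σ` -/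
  first : ∀ k : Fin q, (k : ℕ) = 0 → (i k : ℕ) = 0
  /-- the last occurrence ends at the end of `σ` -/
  last : ∀ k : Fin q, (k : ℕ) + 1 = q → (i k : ℕ) + m = n

/-- The cluster number: the number of `q`-clusters of length `n` for `τ`. By convention, the only
`0`-cluster is the permutation of length one. -/
noncomputable def clusterNumber {m : ℕ} (τ : Equiv.Perm (Fin m)) (n q : ℕ) : ℕ :=
  if q = 0 then (if n = 1 then 1 else 0)
  else Nat.card {c : Equiv.Perm (Fin n) × (Fin q → Fin n) // IsCluster τ c.1 c.2}

/-- A permutation of length `n` has at most `n` occurrences of `τ`. -/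
theorem occurrenceNumber_eq_zero {m : ℕ} (τ : Equiv.Perm (Fin m)) {n k : ℕ} (h : n < k) :
    occurrenceNumber τ n k = 0 := by
  have : IsEmpty {σ : Equiv.Perm (Fin n) // occurrenceCount τ σ = k} := by
    refine ⟨fun ⟨σ, hσ⟩ => ?_⟩
    have h1 := Set.ncard_le_card {i : Fin n | OccursAt τ σ i}
    rw [Nat.card_eq_fintype_card, Fintype.card_fin] at h1
    unfold occurrenceCount at hσ
    omega
  exact Nat.card_of_isEmpty

/-- A permutation of length `n` is never part of a `q`-cluster with `q > n`. -/
theorem clusterNumber_eq_zero {m : ℕ} (τ : Equiv.Perm (Fin m)) {n q : ℕ} (h : n < q) :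
    clusterNumber τ n q = 0 := by
  have : IsEmpty {c : Equiv.Perm (Fin n) × (Fin q → Fin n) // IsCluster τ c.1 c.2} := by
    refine ⟨fun ⟨⟨σ, i⟩, hc⟩ => ?_⟩
    have key : ∀ j : ℕ, ∀ hj : j < q, j ≤ (i ⟨j, hj⟩ : ℕ) := by
      intro j
      induction j with
      | zero => intro _; omega
      | succ j ih =>
        intro hj
        have h1 := ih (by omega)
        have h2 : i ⟨j, by omega⟩ < i ⟨j + 1, hj⟩ := hc.increasing _ _ rfl
        have h3 : (i ⟨j, by omega⟩ : ℕ) < (i ⟨j + 1, hj⟩ : ℕ) := h2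
        omega
    have h1 := key n h
    have h2 := (i ⟨n, h⟩).isLt
    omega
  unfold clusterNumber
  rw [if_neg (by omega)]
  exact Nat.card_of_isEmpty

open Polynomial in
/-- The generating function `∑ π_{n,k} x^n t^k / n!` for occurrences of `τ`, as a formal power
series in `x` with coefficients in `ℚ[t]`; here `π_{n,k} = occurrenceNumber τ n k` vanishes
for `k > n`, so the sum over `k` is finite. -/
noncomputable def occurrenceSeries {m : ℕ} (τ : Equiv.Perm (Fin m)) : PowerSeries ℚ[X] :=
  PowerSeries.mk fun n =>
    ∑ k ∈ Finset.range (n + 1), C ((occurrenceNumber τ n k : ℚ) / (n.factorial : ℚ)) * X ^ k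

open Polynomial in
/-- The series `∑_{n ≥ 2, l ≥ 1} c_{n,l} x^n (t - 1)^l / n!`, as a formal power series in `x` with
coefficients in `ℚ[t]`; here `c_{n,l} = clusterNumber τ n l` vanishes for `l > n`,
so the sum over `l` is finite. -/
noncomputable def clusterSeries {m : ℕ} (τ : Equiv.Perm (Fin m)) : PowerSeries ℚ[X] :=
  PowerSeries.mk fun n =>
    if 2 ≤ n then
      ∑ l ∈ Finset.Icc 1 n,
        C ((clusterNumber τ n l : ℚ) / (n.factorial : ℚ)) * (X - 1) ^ l
    else 0

/-- The pattern `1324`, i.e. `0 ↦ 0`, `1 ↦ 2`, `2 ↦ 1`, `3 ↦ 3` with numbering from `0`. -/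
def pattern1324 : Equiv.Perm (Fin 4) := Equiv.swap 1 2

end ConsecutivePattern

/-! An occurrence of 1324 at place `i` is the chain σ(i) < σ(i+2) < σ(i+1) < σ(i+3), so the
permutations with occurrences at all places of a set `S` are the linear extensions of the relation
`markRel S`; their number is `numMarked S n`. A cluster is then a permutation together with a set of
marked places whose windows cover every adjacent pair of entries (`clusterNumber_eq_sum`).

Recurrence: adjacent places are incompatible (`numMarked_eq_zero`), so a contributing linked set
starts with a maximal run 0, 2, …, 2k-2, followed by a linked set on the entries from 2k+1 on. The
first 2k+1 entries lie below all the others (`lt_of_respects`), so the count factors. The run itself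
is a two-row poset, whose linear extensions satisfy the ballot recurrence and give the Catalan
number (`numLinExts_evenRun`).

Generating function: with t = u + 1, expanding t to the number of occurrences marks an arbitrary
subset of the occurrences with weight u each (`sum_pow_occurrenceCount`). Cutting a marked
permutation after its first linked block gives a binomial convolution (`markedWeight_eq_sum`), which
for exponential generating functions reads F = 1 + (x + K)F, where K is the cluster series. -/

namespace ConsecutivePattern

/-! ### Linear extensions of a relation on a finite set. -/

section LinearExtensions

open Classical in
/-- The enumerations of the finite set `A` by `Fin n` in which `x` is listed after `y`
whenever `r x y`. -/
noncomputable def linExts {ι : Type*} (r : ι → ι → Prop) (n : ℕ) (A : Finset ι) :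
    Finset (Fin n → ι) :=
  (Fintype.piFinset fun _ : Fin n => A).filter fun g =>
    Function.Injective g ∧ (∀ a ∈ A, ∃ i, g i = a) ∧ ∀ i j, r (g i) (g j) → j < i

variable {ι : Type*} {r : ι → ι → Prop}

theorem mem_linExts {n : ℕ} {A : Finset ι} {g : Fin n → ι} :
    g ∈ linExts r n A ↔ (∀ i, g i ∈ A) ∧ Function.Injective g ∧ (∀ a ∈ A, ∃ i, g i = a) ∧
      ∀ i j, r (g i) (g j) → j < i := by
  classical
  simp [linExts]

/-- Enumerations run downwards, so the head must be a maximal element of `A`. -/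
theorem cons_mem_linExts [DecidableEq ι] {n : ℕ} {A : Finset ι} {a : ι} {g : Fin n → ι} :
    (Fin.cons a g : Fin (n + 1) → ι) ∈ linExts r (n + 1) A ↔
      (a ∈ A ∧ ∀ y ∈ A, ¬ r a y) ∧ g ∈ linExts r n (A.erase a) := by
  simp only [mem_linExts, Fin.cons_injective_iff, Fin.forall_fin_succ, Fin.cons_zero,
    Fin.cons_succ, Fin.exists_fin_succ, Finset.mem_erase, lt_irrefl, Set.mem_range, not_exists]
  constructor
  · rintro ⟨⟨ha, hg⟩, ⟨hna, hinj⟩, hs, ⟨h1, h2⟩, h3⟩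
    refine ⟨⟨ha, fun y hy hr => ?_⟩, fun i => ⟨hna i, hg i⟩, hinj, fun b hb => ?_, fun i j hr => ?_⟩
    · rcases hs y hy with rfl | ⟨i, rfl⟩
      · exact h1 hr
      · exact absurd (h2 i hr) (by simp)
    · rcases hs b hb.2 with rfl | h
      · exact absurd rfl hb.1
      · exact h
    · simpa using (h3 i).2 j hr
  · rintro ⟨⟨ha, hmax⟩, hg, hinj, hs, h3⟩
    refine ⟨⟨ha, fun i => (hg i).2⟩, ⟨fun i => (hg i).1, hinj⟩, fun b hb => ?_,
      ⟨fun h => hmax _ ha h, fun i h => absurd h (hmax _ (hg i).2)⟩,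
      fun i => ⟨fun _ => Fin.succ_pos i, fun j h => by simpa using h3 i j h⟩⟩
    by_cases hab : b = a
    · exact Or.inl hab.symm
    · exact Or.inr (hs b ⟨hab, hb⟩)

theorem card_linExts_zero : (linExts r 0 ∅).card = 1 := by
  rw [Finset.card_eq_one]
  refine ⟨Fin.elim0, ?_⟩
  ext g
  simp only [mem_linExts, Finset.mem_singleton]
  refine ⟨fun _ => Subsingleton.elim _ _, fun _ => ?_⟩
  exact ⟨fun i => i.elim0, fun i => i.elim0, by simp, fun i => i.elim0⟩

/-- A linear extension is determined by its largest element and the linear extension of the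
remaining elements. -/
theorem card_linExts_succ [DecidableEq ι] (n : ℕ) (A : Finset ι)
    [DecidablePred fun a => ∀ y ∈ A, ¬ r a y] :
    (linExts r (n + 1) A).card =
      ∑ a ∈ A with ∀ y ∈ A, ¬ r a y, (linExts r n (A.erase a)).card := by
  rw [Finset.card_eq_sum_card_fiberwise (f := fun g => g 0)
    (t := A.filter fun a => ∀ y ∈ A, ¬ r a y)]
  · refine Finset.sum_congr rfl fun a ha => ?_
    refine Finset.card_nbij' Fin.tail (fun g => Fin.cons a g) ?_ ?_ ?_ ?_
    · intro g hg
      simp only [Finset.coe_filter, Set.mem_ofPred_eq] at hg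
      obtain ⟨hg, rfl⟩ := hg
      rw [← Fin.cons_self_tail g] at hg
      exact (cons_mem_linExts.1 hg).2
    · intro g hg
      simp only [Finset.coe_filter, Set.mem_ofPred_eq, Fin.cons_zero, and_true]
      exact cons_mem_linExts.2 ⟨Finset.mem_filter.1 ha, hg⟩
    · intro g hg
      simp only [Finset.coe_filter, Set.mem_ofPred_eq] at hg
      obtain ⟨hg, rfl⟩ := hg
      exact Fin.cons_self_tail g
    · intro g hg
      exact Fin.tail_cons (α := fun _ => ι) a g
  · intro g hg
    rw [Finset.mem_coe, ← Fin.cons_self_tail g] at hg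
    exact Finset.mem_coe.2 (Finset.mem_filter.2 (cons_mem_linExts.1 hg).1)

/-- The number of linear extensions of `r` on the finite set `A`. -/
noncomputable def numLinExts (r : ι → ι → Prop) (A : Finset ι) : ℕ :=
  (linExts r A.card A).card

@[simp] theorem numLinExts_empty : numLinExts r ∅ = 1 := card_linExts_zero

theorem numLinExts_eq_sum [DecidableEq ι] {A : Finset ι}
    [DecidablePred fun a => ∀ y ∈ A, ¬ r a y] (hA : A.Nonempty) :
    numLinExts r A = ∑ a ∈ A with ∀ y ∈ A, ¬ r a y, numLinExts r (A.erase a) := by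
  obtain ⟨n, hn⟩ := Nat.exists_eq_succ_of_ne_zero hA.card_ne_zero
  rw [numLinExts, hn, card_linExts_succ]
  refine Finset.sum_congr rfl fun a ha => ?_
  rw [numLinExts, Finset.card_erase_of_mem (Finset.mem_filter.1 ha).1, hn]
  rfl

theorem numLinExts_eq_sum_of_mem_iff [DecidableEq ι] {A F : Finset ι} (hA : A.Nonempty)
    (hF : ∀ a, (a ∈ A ∧ ∀ y ∈ A, ¬ r a y) ↔ a ∈ F) :
    numLinExts r A = ∑ a ∈ F, numLinExts r (A.erase a) := by
  classical
  rw [numLinExts_eq_sum hA]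
  exact Finset.sum_congr (Finset.ext fun a => by rw [Finset.mem_filter, hF]) fun _ _ => rfl

theorem numLinExts_congr {s : ι → ι → Prop} {A : Finset ι}
    (h : ∀ x ∈ A, ∀ y ∈ A, r x y ↔ s x y) : numLinExts r A = numLinExts s A := by
  unfold numLinExts
  congr 1
  ext g
  simp only [mem_linExts]
  refine and_congr_right fun hg => and_congr_right fun _ => and_congr_right fun _ => ?_
  exact forall_congr' fun i => forall_congr' fun j => by rw [h _ (hg i) _ (hg j)]

theorem numLinExts_map {κ : Type*} (f : κ ↪ ι) (A : Finset κ) :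
    numLinExts r (A.map f) = numLinExts (fun x y => r (f x) (f y)) A := by
  classical
  induction A using Finset.strongInduction with
  | H A ih =>
    rcases A.eq_empty_or_nonempty with rfl | hA
    · simp
    · rw [numLinExts_eq_sum hA, numLinExts_eq_sum (hA.map), Finset.filter_map, Finset.sum_map]
      refine Finset.sum_congr (by ext; simp) fun a ha => ?_
      rw [← Finset.map_erase, ih _ (Finset.erase_ssubset (Finset.mem_filter.1 ha).1)]

/-- Linear extensions of an ordinal sum. -/
theorem numLinExts_union_of_lt [DecidableEq ι] {A B : Finset ι}
    (h1 : ∀ a ∈ A, ∀ b ∈ B, r a b) (h2 : ∀ a ∈ A, ∀ b ∈ B, ¬ r b a) :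
    Disjoint A B → numLinExts r (A ∪ B) = numLinExts r A * numLinExts r B := by
  classical
  induction B using Finset.strongInduction with
  | H B ih =>
    intro hd
    rcases B.eq_empty_or_nonempty with rfl | hB
    · simp
    · rw [numLinExts_eq_sum hB, numLinExts_eq_sum (hB.mono Finset.subset_union_right),
        Finset.mul_sum]
      -- Since `B` is nonempty, no element of `A` is maximal in the union.
      have hF : ((A ∪ B).filter fun a => ∀ y ∈ A ∪ B, ¬ r a y) =
          B.filter fun a => ∀ y ∈ B, ¬ r a y := by
        ext b
        simp only [Finset.mem_filter, Finset.mem_union]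
        constructor
        · rintro ⟨hb | hb, h⟩
          · obtain ⟨c, hc⟩ := hB
            exact absurd (h1 b hb c hc) (h c (Or.inr hc))
          · exact ⟨hb, fun y hy => h y (Or.inr hy)⟩
        · rintro ⟨hb, h⟩
          exact ⟨Or.inr hb, fun y hy => hy.elim (fun hy => h2 y hy b hb) (h y)⟩
      rw [hF]
      refine Finset.sum_congr rfl fun b hb => ?_
      have hbB := (Finset.mem_filter.1 hb).1
      have hbA : b ∉ A := fun h => Finset.disjoint_left.1 hd h hbB
      rw [Finset.erase_union_distrib, Finset.erase_eq_of_notMem hbA]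
      exact ih _ (Finset.erase_ssubset hbB)
        (fun a ha c hc => h1 a ha c (Finset.mem_of_mem_erase hc))
        (fun a ha c hc => h2 a ha c (Finset.mem_of_mem_erase hc))
        (hd.mono_right (Finset.erase_subset _ _))

/-- Linear extensions of a disjoint sum. -/
theorem numLinExts_union_of_not [DecidableEq ι] {A B : Finset ι}
    (h1 : ∀ a ∈ A, ∀ b ∈ B, ¬ r a b) (h2 : ∀ a ∈ A, ∀ b ∈ B, ¬ r b a) (hd : Disjoint A B) :
    numLinExts r (A ∪ B) =
      (A.card + B.card).choose A.card * numLinExts r A * numLinExts r B := by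
  classical
  induction hn : A.card + B.card generalizing A B with
  | zero =>
    obtain ⟨hA, hB⟩ : A = ∅ ∧ B = ∅ := by
      rw [Nat.add_eq_zero_iff] at hn
      simpa using hn
    subst hA hB
    simp
  | succ n ih =>
    rcases A.eq_empty_or_nonempty with rfl | hA
    · simp
    rcases B.eq_empty_or_nonempty with rfl | hB
    · simp only [Finset.card_empty, Nat.add_zero] at hn
      simp [hn]
    have hF : ((A ∪ B).filter fun a => ∀ y ∈ A ∪ B, ¬ r a y) =
        (A.filter fun a => ∀ y ∈ A, ¬ r a y) ∪ (B.filter fun a => ∀ y ∈ B, ¬ r a y) := by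
      ext b
      simp only [Finset.mem_filter, Finset.mem_union]
      constructor
      · rintro ⟨hb | hb, h⟩
        · exact Or.inl ⟨hb, fun y hy => h y (Or.inl hy)⟩
        · exact Or.inr ⟨hb, fun y hy => h y (Or.inr hy)⟩
      · rintro (⟨hb, h⟩ | ⟨hb, h⟩)
        · exact ⟨Or.inl hb, fun y hy => hy.elim (h y) (h1 b hb y)⟩
        · exact ⟨Or.inr hb, fun y hy => hy.elim (fun hy => h2 y hy b hb) (h y)⟩
    rw [numLinExts_eq_sum (hA.mono Finset.subset_union_left), hF, Finset.sum_union
      (hd.mono (Finset.filter_subset _ _) (Finset.filter_subset _ _))]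
    obtain ⟨p, hp⟩ := Nat.exists_eq_succ_of_ne_zero hA.card_ne_zero
    have e1 : ∀ a ∈ A.filter fun a => ∀ y ∈ A, ¬ r a y, numLinExts r ((A ∪ B).erase a) =
        n.choose p * numLinExts r (A.erase a) * numLinExts r B := by
      intro a ha
      have haA := (Finset.mem_filter.1 ha).1
      have haB : a ∉ B := fun h => Finset.disjoint_left.1 hd haA h
      have hc := Finset.card_erase_of_mem haA
      rw [Finset.erase_union_distrib, Finset.erase_eq_of_notMem haB,
        ih (fun a ha c hc => h1 a (Finset.mem_of_mem_erase ha) c hc)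
        (fun a ha c hc => h2 a (Finset.mem_of_mem_erase ha) c hc)
        (hd.mono_left (Finset.erase_subset _ _)) (by omega)]
      rw [show (A.erase a).card = p by omega]
    have e2 : ∀ b ∈ B.filter fun a => ∀ y ∈ B, ¬ r a y, numLinExts r ((A ∪ B).erase b) =
        n.choose (p + 1) * numLinExts r A * numLinExts r (B.erase b) := by
      intro b hb
      have hbB := (Finset.mem_filter.1 hb).1
      have hbA : b ∉ A := fun h => Finset.disjoint_left.1 hd h hbB
      have hc := Finset.card_erase_of_mem hbB
      have hB0 := hB.card_pos
      rw [Finset.erase_union_distrib, Finset.erase_eq_of_notMem hbA,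
        ih (fun a ha c hc => h1 a ha c (Finset.mem_of_mem_erase hc))
        (fun a ha c hc => h2 a ha c (Finset.mem_of_mem_erase hc))
        (hd.mono_right (Finset.erase_subset _ _)) (by omega)]
      rw [show A.card = p + 1 by omega]
    -- The largest element comes from `A` or from `B`; the two binomials add up by Pascal's rule.
    rw [Finset.sum_congr rfl e1, Finset.sum_congr rfl e2, ← Finset.mul_sum, ← Finset.sum_mul,
      ← Finset.mul_sum, ← numLinExts_eq_sum hA, ← numLinExts_eq_sum hB,
      show A.card = p + 1 by omega, Nat.choose_succ_succ]
    ring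

/-- The permutations of `Fin n` that respect a relation are counted by linear extensions. -/
theorem card_perm_respecting (r : ℕ → ℕ → Prop) (n : ℕ)
    [DecidablePred fun σ : Equiv.Perm (Fin n) => ∀ x y : Fin n, r x y → σ x < σ y] :
    (Finset.univ.filter fun σ : Equiv.Perm (Fin n) => ∀ x y : Fin n, r x y → σ x < σ y).card =
      numLinExts r (Finset.range n) := by
  rw [numLinExts, Finset.card_range]
  -- `rev` appears because enumerations list the place of the largest value first.
  refine Finset.card_bij (fun σ _ i => ((σ.symm i.rev : Fin n) : ℕ)) ?_ ?_ ?_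
  · intro σ hσ
    simp only [Finset.mem_filter, Finset.mem_univ, true_and] at hσ
    rw [mem_linExts]
    refine ⟨fun i => by simp, fun i j h => ?_, fun a ha => ?_, fun i j h => ?_⟩
    · simpa [Fin.val_inj] using h
    · refine ⟨(σ ⟨a, by simpa using ha⟩).rev, by simp⟩
    · simpa using hσ _ _ h
  · intro σ _ τ _ h
    have : σ.symm = τ.symm := by
      ext i
      simpa using congrFun h i.rev
    simpa using congrArg Equiv.symm this
  · intro g hg
    rw [mem_linExts] at hg
    obtain ⟨h1, h2, h3, h4⟩ := hg
    let f : Fin n → Fin n := fun i => ⟨g i.rev, by simpa using h1 i.rev⟩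
    have hf : Function.Bijective f := by
      rw [Finite.injective_iff_bijective.symm]
      intro i j h
      simpa using h2 (Fin.mk.inj h)
    refine ⟨(Equiv.ofBijective f hf).symm, ?_, ?_⟩
    · simp only [Finset.mem_filter, Finset.mem_univ, true_and]
      intro x y h
      obtain ⟨i, rfl⟩ := hf.2 x
      obtain ⟨j, rfl⟩ := hf.2 y
      simp only [Equiv.ofBijective_symm_apply_apply]
      simpa using h4 i.rev j.rev h
    · ext i
      simp [f]

end LinearExtensions

/-! ### Permutations with prescribed occurrences. -/

section MarkedPlaces

/-- The inequalities between the entries of a permutation which say that `1324` occurs at each of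
the places in `S`. -/
def markRel (S : Finset ℕ) (x y : ℕ) : Prop :=
  ∃ i ∈ S, (x = i ∧ y = i + 2) ∨ (x = i + 2 ∧ y = i + 1) ∨ (x = i + 1 ∧ y = i + 3)

/-- The number of permutations of length `n` with an occurrence of `1324` at each place in `S`. -/
noncomputable def numMarked (S : Finset ℕ) (n : ℕ) : ℕ :=
  numLinExts (markRel S) (Finset.range n)

theorem occursAt_pattern1324_iff {n : ℕ} (σ : Equiv.Perm (Fin n)) (i : Fin n) :
    OccursAt pattern1324 σ i ↔ ∃ h : (i : ℕ) + 4 ≤ n,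
      σ i < σ ⟨i + 2, by omega⟩ ∧ σ ⟨i + 2, by omega⟩ < σ ⟨i + 1, by omega⟩ ∧
        σ ⟨i + 1, by omega⟩ < σ ⟨i + 3, by omega⟩ := by
  unfold OccursAt
  refine exists_congr fun h => ?_
  constructor
  · intro hs
    exact ⟨(hs 0 2).2 (by decide), (hs 2 1).2 (by decide), (hs 1 3).2 (by decide)⟩
  · rintro ⟨h1, h2, h3⟩
    have p0 : pattern1324 0 = 0 := by decide
    have p1 : pattern1324 1 = 2 := by decide
    have p2 : pattern1324 2 = 1 := by decide
    have p3 : pattern1324 3 = 3 := by decide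
    intro a b
    simp only [Fin.lt_def] at h1 h2 h3 ⊢
    fin_cases a <;> fin_cases b <;> simp [p0, p1, p2, p3] <;> omega

theorem forall_occursAt_iff {n : ℕ} {S : Finset ℕ} (hS : ∀ i ∈ S, i + 4 ≤ n)
    (σ : Equiv.Perm (Fin n)) :
    (∀ i : Fin n, (i : ℕ) ∈ S → OccursAt pattern1324 σ i) ↔
      ∀ x y : Fin n, markRel S x y → σ x < σ y := by
  simp only [occursAt_pattern1324_iff]
  constructor
  · rintro h ⟨x, hx⟩ ⟨y, hy⟩ ⟨i, hi, hxy⟩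
    obtain ⟨hn, h1, h2, h3⟩ := h ⟨i, by have := hS i hi; omega⟩ hi
    simp only at hxy
    rcases hxy with ⟨rfl, rfl⟩ | ⟨rfl, rfl⟩ | ⟨rfl, rfl⟩ <;> assumption
  · intro h i hi
    exact ⟨hS i hi, h _ _ ⟨i, hi, Or.inl ⟨rfl, rfl⟩⟩, h _ _ ⟨i, hi, Or.inr (Or.inl ⟨rfl, rfl⟩)⟩,
      h _ _ ⟨i, hi, Or.inr (Or.inr ⟨rfl, rfl⟩)⟩⟩

theorem card_forall_occursAt {n : ℕ} {S : Finset ℕ} (hS : ∀ i ∈ S, i + 4 ≤ n)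
    [DecidablePred fun σ : Equiv.Perm (Fin n) =>
      ∀ i : Fin n, (i : ℕ) ∈ S → OccursAt pattern1324 σ i] :
    (Finset.univ.filter fun σ : Equiv.Perm (Fin n) =>
      ∀ i : Fin n, (i : ℕ) ∈ S → OccursAt pattern1324 σ i).card = numMarked S n := by
  classical
  rw [numMarked, ← card_perm_respecting]
  exact congrArg Finset.card (Finset.filter_congr fun σ _ => forall_occursAt_iff hS σ)

/-- The marked places `S`, followed by the marked places `T` moved by `m`. -/
def shiftUnion (m : ℕ) (S T : Finset ℕ) : Finset ℕ := S ∪ T.map (addRightEmbedding m)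

theorem mem_shiftUnion {m : ℕ} {S T : Finset ℕ} {x : ℕ} :
    x ∈ shiftUnion m S T ↔ x ∈ S ∨ ∃ y ∈ T, y + m = x := by
  simp [shiftUnion]

theorem range_add_eq (m d : ℕ) :
    Finset.range (m + d) =
      Finset.range m ∪ (Finset.range d).map (addRightEmbedding m) := by
  ext x
  simp only [Finset.mem_range, Finset.mem_union, Finset.mem_map, addRightEmbedding_apply]
  refine ⟨fun h => ?_, ?_⟩
  · by_cases hx : x < m
    · exact Or.inl hx
    · exact Or.inr ⟨x - m, by omega, by omega⟩
  · rintro (h | ⟨y, hy, rfl⟩) <;> omega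

theorem disjoint_range_map (m d : ℕ) :
    Disjoint (Finset.range m) ((Finset.range d).map (addRightEmbedding m)) := by
  rw [Finset.disjoint_left]
  intro x hx hx'
  simp only [Finset.mem_range, Finset.mem_map, addRightEmbedding_apply] at hx hx'
  obtain ⟨y, -, rfl⟩ := hx'
  omega

/-- If the marked places do not link the first `m` entries to the others, then the two parts are
independent. -/
theorem numMarked_shiftUnion {m d : ℕ} {S T : Finset ℕ} (hS : ∀ i ∈ S, i + 4 ≤ m) :
    numMarked (shiftUnion m S T) (m + d) =
      (m + d).choose m * numMarked S m * numMarked T d := by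
  have key : ∀ x y, markRel (shiftUnion m S T) x y ↔
      (x < m ∧ y < m ∧ markRel S x y) ∨ ∃ x' y', x = x' + m ∧ y = y' + m ∧ markRel T x' y' := by
    intro x y
    simp only [markRel, mem_shiftUnion]
    constructor
    · rintro ⟨i, hi | ⟨j, hj, rfl⟩, h⟩
      · have := hS i hi
        exact Or.inl ⟨by omega, by omega, i, hi, h⟩
      · exact Or.inr ⟨x - m, y - m, by omega, by omega, j, hj, by omega⟩
    · rintro (⟨-, -, i, hi, h⟩ | ⟨x', y', rfl, rfl, i, hi, h⟩)
      · exact ⟨i, Or.inl hi, h⟩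
      · exact ⟨i + m, Or.inr ⟨i, hi, rfl⟩, by omega⟩
  unfold numMarked
  rw [range_add_eq, numLinExts_union_of_not _ _ (disjoint_range_map m d), Finset.card_map,
    Finset.card_range, Finset.card_range, numLinExts_map]
  · congr 1
    · congr 1
      refine numLinExts_congr fun x hx y hy => ?_
      rw [key]
      simp only [Finset.mem_range] at hx hy
      refine ⟨?_, fun h => Or.inl ⟨hx, hy, h⟩⟩
      rintro (h | ⟨x', y', h, -⟩)
      · exact h.2.2
      · omega
    · refine numLinExts_congr fun x hx y hy => ?_
      rw [key]
      simp only [addRightEmbedding_apply]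
      refine ⟨?_, fun h => Or.inr ⟨x, y, rfl, rfl, h⟩⟩
      rintro (h | ⟨x', y', h, h', h''⟩)
      · omega
      · rwa [show x = x' by omega, show y = y' by omega]
  all_goals
    intro a ha b hb
    simp only [Finset.mem_range, Finset.mem_map, addRightEmbedding_apply] at ha hb
    obtain ⟨b, -, rfl⟩ := hb
    rw [key]
    rintro (h | ⟨x', y', h, h', -⟩) <;> omega

/-- The marked places `S` link all the entries of a permutation of length `n`. -/
def IsLinked (n : ℕ) (S : Finset ℕ) : Prop :=
  (∀ i ∈ S, i + 4 ≤ n) ∧ ∀ x, x + 1 < n → ∃ i ∈ S, i ≤ x ∧ x ≤ i + 2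

/-- The places `0, 2, …, 2k - 2`. -/
def evenRun (k : ℕ) : Finset ℕ := (Finset.range (2 * k)).filter fun i => i % 2 = 0

theorem mem_evenRun {k i : ℕ} : i ∈ evenRun k ↔ i < 2 * k ∧ i % 2 = 0 := by
  simp [evenRun]

/-- Entries increase along the even places and along the odd places, and each even place from 2 on
lies below its left neighbour. The relation from 2k-1 to 2k+1 is the only one that leaves the first
2k+1 places. -/
theorem markRel_evenRun {k x y : ℕ} : markRel (evenRun k) x y ↔
    (x % 2 = 0 ∧ x < 2 * k ∧ y = x + 2) ∨ (x % 2 = 0 ∧ x ≤ 2 * k ∧ y + 1 = x ∧ 2 ≤ x) ∨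
      (x % 2 = 1 ∧ x < 2 * k ∧ y = x + 2) := by
  simp only [markRel, mem_evenRun]
  constructor
  · rintro ⟨i, hi, h⟩
    omega
  · rintro (h | h | h)
    · exact ⟨x, by omega, by omega⟩
    · exact ⟨x - 2, by omega, by omega⟩
    · exact ⟨x - 1, by omega, by omega⟩

/-- If `1324` occurs at the places `0, 2, …, 2k - 2` and at places which link the entries from
`2k + 1` on, then the first `2k + 1` entries are smaller than the others. -/
theorem lt_of_respects {k d : ℕ} (hk : 1 ≤ k) {T : Finset ℕ} (hT : IsLinked d T) {f : ℕ → ℕ}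
    (hf : ∀ x y, x < 2 * k + 1 + d → y < 2 * k + 1 + d →
      markRel (shiftUnion (2 * k + 1) (evenRun k) T) x y → f x < f y)
    {x y : ℕ} (hx : x < 2 * k + 1) (hy : 2 * k + 1 ≤ y) (hyn : y < 2 * k + 1 + d) : f x < f y := by
  have hrun : ∀ x y, x < 2 * k + 1 + d → y < 2 * k + 1 + d → markRel (evenRun k) x y →
      f x < f y := by
    rintro x y hx hy ⟨i, hi, h⟩
    exact hf x y hx hy ⟨i, mem_shiftUnion.2 (Or.inl hi), h⟩
  -- The entry at 2k-1 is the maximum of the run: induction down the odd places, to which the even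
  -- ones are then compared.
  have hodd : ∀ j, j < k → f (2 * (k - 1 - j) + 1) ≤ f (2 * k - 1) := by
    intro j
    induction j with
    | zero => intro _; exact le_of_eq (congrArg f (by omega))
    | succ j ih =>
      intro hj
      refine le_trans (le_of_lt (hrun _ _ (by omega) (by omega) (markRel_evenRun.2 ?_)))
        (ih (by omega))
      omega
  have hodd' : ∀ x, x % 2 = 1 → x < 2 * k → f x ≤ f (2 * k - 1) := by
    intro x h1 h2
    have := hodd (k - 1 - x / 2) (by omega)
    rwa [show 2 * (k - 1 - (k - 1 - x / 2)) + 1 = x by omega] at this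
  have hle : f x ≤ f (2 * k - 1) := by
    by_cases h1 : x % 2 = 1
    · exact hodd' x h1 (by omega)
    · by_cases h2 : x = 0
      · subst h2
        have h3 : f 0 < f 2 := hrun _ _ (by omega) (by omega) (markRel_evenRun.2 (by omega))
        have h4 : f 2 < f 1 := hrun _ _ (by omega) (by omega) (markRel_evenRun.2 (by omega))
        have := hodd' 1 (by omega) (by omega)
        omega
      · refine le_trans (le_of_lt (hrun x (x - 1) (by omega) (by omega)
          (markRel_evenRun.2 (by omega)))) (hodd' _ (by omega) (by omega))
  have hmid : f (2 * k - 1) < f (2 * k + 1) :=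
    hrun _ _ (by omega) (by omega) (markRel_evenRun.2 (by omega))
  -- The first entry of the linked tail is its minimum: each later entry is in a window that starts
  -- further left, and a window starts with its least entry.
  have hge : ∀ z, z < d → f (2 * k + 1) ≤ f (z + (2 * k + 1)) := by
    intro z
    induction z using Nat.strong_induction_on with
    | _ z ih =>
      intro hz
      rcases Nat.eq_zero_or_pos z with rfl | hz0
      · simp
      obtain ⟨i, hi, h1, h2⟩ := hT.2 (z - 1) (by omega)
      have hid := hT.1 i hi
      refine le_trans (ih i (by omega) (by omega)) (le_of_lt ?_)
      have hm : ∀ x y, x < d → y < d → (x = i ∧ y = i + 2) ∨ (x = i + 2 ∧ y = i + 1) ∨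
          (x = i + 1 ∧ y = i + 3) → f (x + (2 * k + 1)) < f (y + (2 * k + 1)) := by
        intro x y hx hy h
        exact hf _ _ (by omega) (by omega)
          ⟨i + (2 * k + 1), mem_shiftUnion.2 (Or.inr ⟨i, hi, rfl⟩), by omega⟩
      have e1 := hm i (i + 2) (by omega) (by omega) (by omega)
      have e2 := hm (i + 2) (i + 1) (by omega) (by omega) (by omega)
      have e3 := hm (i + 1) (i + 3) (by omega) (by omega) (by omega)
      obtain rfl | rfl | rfl : z = i + 1 ∨ z = i + 2 ∨ z = i + 3 := by omega
      · exact e1.trans e2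
      · exact e1
      · exact (e1.trans e2).trans e3
  have := hge (y - (2 * k + 1)) (by omega)
  rw [show y - (2 * k + 1) + (2 * k + 1) = y by omega] at this
  omega

/-- The inequalities forced by `lt_of_respects` may be added to the relation without changing the
count; the result is an ordinal sum. -/
theorem numMarked_evenRun_shiftUnion {k d : ℕ} (hk : 1 ≤ k) {T : Finset ℕ} (hT : IsLinked d T) :
    numMarked (shiftUnion (2 * k + 1) (evenRun k) T) (2 * k + 1 + d) =
      numLinExts (markRel (evenRun k)) (Finset.range (2 * k + 1)) * numMarked T d := by
  classical
  set S := shiftUnion (2 * k + 1) (evenRun k) T with hS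
  set r : ℕ → ℕ → Prop := fun x y => markRel S x y ∨ (x < 2 * k + 1 ∧ 2 * k + 1 ≤ y) with hr
  have key : ∀ x y, markRel S x y ↔ markRel (evenRun k) x y ∨
      ∃ x' y', x = x' + (2 * k + 1) ∧ y = y' + (2 * k + 1) ∧ markRel T x' y' := by
    intro x y
    simp only [markRel, hS, mem_shiftUnion]
    constructor
    · rintro ⟨i, hi | ⟨j, hj, rfl⟩, h⟩
      · exact Or.inl ⟨i, hi, h⟩
      · exact Or.inr ⟨x - (2 * k + 1), y - (2 * k + 1), by omega, by omega, j, hj, by omega⟩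
    · rintro (⟨i, hi, h⟩ | ⟨x', y', rfl, rfl, i, hi, h⟩)
      · exact ⟨i, Or.inl hi, h⟩
      · exact ⟨i + (2 * k + 1), Or.inr ⟨i, hi, rfl⟩, by omega⟩
  have e : numMarked S (2 * k + 1 + d) = numLinExts r (Finset.range (2 * k + 1 + d)) := by
    rw [numMarked, ← card_perm_respecting, ← card_perm_respecting]
    refine congrArg Finset.card (Finset.filter_congr fun σ _ => ?_)
    refine ⟨fun h x y hxy => ?_, fun h x y hxy => h x y (Or.inl hxy)⟩
    rcases hxy with hxy | hxy
    · exact h x y hxy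
    -- The default value 0 plays no role: only places below 2k+1+d are compared.
    · let f : ℕ → ℕ := fun z => if hz : z < 2 * k + 1 + d then (σ ⟨z, hz⟩ : ℕ) else 0
      have hf : ∀ z : Fin (2 * k + 1 + d), f z = σ z := fun z => by simp [f]
      have := lt_of_respects hk hT (f := f) (fun x y hx hy hxy => ?_) hxy.1 hxy.2 y.2
      · rwa [hf, hf] at this
      · have := h ⟨x, hx⟩ ⟨y, hy⟩ hxy
        simpa [f, hx, hy] using this
  rw [e, range_add_eq, numLinExts_union_of_lt _ _ (disjoint_range_map _ d), numLinExts_map]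
  · congr 1
    · refine numLinExts_congr fun x hx y hy => ?_
      simp only [Finset.mem_range] at hx hy
      simp only [hr, key]
      refine ⟨?_, fun h => Or.inl (Or.inl h)⟩
      rintro ((h | ⟨x', y', h, -⟩) | h)
      · exact h
      · omega
      · omega
    · refine numLinExts_congr fun x hx y hy => ?_
      simp only [addRightEmbedding_apply, hr, key, markRel_evenRun]
      refine ⟨?_, fun h => Or.inl (Or.inr ⟨x, y, rfl, rfl, h⟩)⟩
      rintro ((h | ⟨x', y', h, h', h''⟩) | h)
      · omega
      · rwa [show x = x' by omega, show y = y' by omega]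
      · omega
  all_goals
    intro a ha b hb
    simp only [Finset.mem_range, Finset.mem_map, addRightEmbedding_apply] at ha hb
    obtain ⟨b, -, rfl⟩ := hb
  · exact Or.inr ⟨ha, by omega⟩
  · simp only [hr, key, markRel_evenRun]
    rintro ((h | ⟨x', y', h, h', -⟩) | h) <;> omega

/-! ### Ladders, ballot numbers and Catalan numbers. -/

/-- The places `0, 2, …, 2p` and `1, 3, …, 2q - 1`. -/
def ladder (p q : ℕ) : Finset ℕ :=
  (Finset.range (2 * p + 2 * q + 1)).filter fun x =>
    (x % 2 = 0 ∧ x ≤ 2 * p) ∨ (x % 2 = 1 ∧ x < 2 * q)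

theorem mem_ladder {p q x : ℕ} :
    x ∈ ladder p q ↔ (x % 2 = 0 ∧ x ≤ 2 * p) ∨ (x % 2 = 1 ∧ x < 2 * q) := by
  simp only [ladder, Finset.mem_filter, Finset.mem_range]
  omega

theorem ladder_self (k : ℕ) : ladder k k = Finset.range (2 * k + 1) := by
  ext x
  simp only [mem_ladder, Finset.mem_range]
  omega

theorem erase_ladder_left (p q : ℕ) : (ladder (p + 1) q).erase (2 * p + 2) = ladder p q := by
  ext x
  simp only [mem_ladder, Finset.mem_erase]
  omega

theorem erase_ladder_right (p q : ℕ) : (ladder p (q + 1)).erase (2 * q + 1) = ladder p q := by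
  ext x
  simp only [mem_ladder, Finset.mem_erase]
  omega

theorem numLinExts_ladder_zero (k : ℕ) : numLinExts (markRel (evenRun k)) (ladder 0 0) = 1 := by
  classical
  have h : ladder 0 0 = {0} := by
    ext x
    simp only [mem_ladder, Finset.mem_singleton]
    omega
  rw [h, numLinExts_eq_sum (Finset.singleton_nonempty 0), Finset.filter_true_of_mem]
  · simp
  · simp [markRel_evenRun]

/-- Only the ends of the two rows can be maximal. The even end 2p+2 lies below 2p+1, so it is
maximal exactly when 2p+1 is absent; the odd end 2q-1, present for q ≥ 1, always is. -/
theorem maximal_ladder_iff {k p q : ℕ} (hq : q ≤ p + 1) (hp : p + 1 ≤ k) (a : ℕ) :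
    (a ∈ ladder (p + 1) q ∧ ∀ y ∈ ladder (p + 1) q, ¬ markRel (evenRun k) a y) ↔
      (a = 2 * p + 2 ∧ q ≤ p) ∨ (a + 1 = 2 * q) := by
  simp only [mem_ladder, markRel_evenRun]
  constructor
  · rintro ⟨h1, h2⟩
    have h3 := h2 (a + 2)
    have h4 := h2 (a - 1)
    omega
  · intro h
    refine ⟨by omega, fun y hy => by omega⟩

theorem numLinExts_ladder_succ_zero {k p : ℕ} (hp : p + 1 ≤ k) :
    numLinExts (markRel (evenRun k)) (ladder (p + 1) 0) =
      numLinExts (markRel (evenRun k)) (ladder p 0) := by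
  rw [numLinExts_eq_sum_of_mem_iff (F := {2 * p + 2}) ⟨0, mem_ladder.2 (by omega)⟩ fun a => by
    rw [maximal_ladder_iff (by omega) hp]; simp]
  rw [Finset.sum_singleton, erase_ladder_left]

/-- Off the diagonal both row ends can be removed: this is the recurrence of the ballot triangle. -/
theorem numLinExts_ladder_succ_succ {k p q : ℕ} (hq : q + 1 ≤ p) (hp : p + 1 ≤ k) :
    numLinExts (markRel (evenRun k)) (ladder (p + 1) (q + 1)) =
      numLinExts (markRel (evenRun k)) (ladder p (q + 1)) +
      numLinExts (markRel (evenRun k)) (ladder (p + 1) q) := by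
  rw [numLinExts_eq_sum_of_mem_iff (F := {2 * p + 2, 2 * q + 1})
    ⟨0, mem_ladder.2 (by omega)⟩ fun a => by
    rw [maximal_ladder_iff (by omega) hp]; simp; omega]
  rw [Finset.sum_pair (by omega), erase_ladder_left, erase_ladder_right]

theorem numLinExts_ladder_diag {k p : ℕ} (hp : p + 1 ≤ k) :
    numLinExts (markRel (evenRun k)) (ladder (p + 1) (p + 1)) =
      numLinExts (markRel (evenRun k)) (ladder (p + 1) p) := by
  rw [numLinExts_eq_sum_of_mem_iff (F := {2 * p + 1}) ⟨0, mem_ladder.2 (by omega)⟩ fun a => by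
    rw [maximal_ladder_iff (by omega) hp]; simp; omega]
  rw [Finset.sum_singleton, erase_ladder_right]

/-- The ballot numbers. -/
theorem numLinExts_ladder {k p q : ℕ} (hq : q ≤ p) (hp : p ≤ k) :
    (numLinExts (markRel (evenRun k)) (ladder p q) : ℚ) * (p + 1) =
      (p + 1 - q) * ((p + q).choose q : ℚ) := by
  induction p generalizing q with
  | zero =>
    obtain rfl : q = 0 := by omega
    simp [numLinExts_ladder_zero]
  | succ p ihp =>
    induction q with
    | zero =>
      have h := ihp (q := 0) (by omega) (by omega)
      simp only [Nat.cast_zero, sub_zero, Nat.choose_zero_right, Nat.cast_one, mul_one] at h ⊢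
      have hp0 : (p : ℚ) + 1 ≠ 0 := by positivity
      rw [numLinExts_ladder_succ_zero hp]
      have h1 : (numLinExts (markRel (evenRun k)) (ladder p 0) : ℚ) = 1 := by
        apply mul_right_cancel₀ hp0
        linarith
      rw [h1, one_mul]
    | succ q ihq =>
      have h2 := ihq (by omega)
      -- The ratio of neighbouring binomials reduces the ballot recurrence to a linear identity.
      have hc : ((p + 1 + q).choose (q + 1) : ℚ) * (q + 1) = (p + 1 + q).choose q * (p + 1) := by
        have := Nat.choose_succ_right_eq (p + 1 + q) q
        rw [show p + 1 + q - q = p + 1 by omega] at this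
        exact_mod_cast this
      have hp0 : (p : ℚ) + 1 ≠ 0 := by positivity
      rw [show p + 1 + (q + 1) = (p + 1 + q) + 1 by ring, Nat.choose_succ_succ]
      push_cast at h2 ⊢
      apply mul_right_cancel₀ hp0
      rcases Nat.eq_or_lt_of_le hq with h | h
      · obtain rfl : q = p := by omega
        rw [numLinExts_ladder_diag hp]
        linear_combination (q + 1 : ℚ) * h2 - hc
      · have h1 := ihp (q := q + 1) (by omega) (by omega)
        rw [numLinExts_ladder_succ_succ (by omega) hp]
        rw [show p + (q + 1) = p + 1 + q by ring] at h1
        push_cast at h1 ⊢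
        linear_combination (p + 2 : ℚ) * h1 + (p + 1 : ℚ) * h2 - hc

/-- The full run is the diagonal ladder, whose ballot number is the Catalan number. -/
theorem numLinExts_evenRun (k : ℕ) :
    (numLinExts (markRel (evenRun k)) (Finset.range (2 * k + 1)) : ℚ) =
      1 / ((k : ℚ) + 1) * (Nat.choose (2 * k) k : ℚ) := by
  have h := numLinExts_ladder (le_refl k) (le_refl k)
  have hk : (k : ℚ) + 1 ≠ 0 := by positivity
  rw [ladder_self, ← two_mul] at h
  field_simp
  linarith

end MarkedPlaces

/-! ### Clusters as linked sets of marked places. -/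

section Clusters

open Classical in
/-- The sets of `q` marked places which link all the entries of a permutation of length `n`. -/
noncomputable def linkedSets (n q : ℕ) : Finset (Finset ℕ) :=
  ((Finset.range n).powersetCard q).filter (IsLinked n)

theorem mem_linkedSets {n q : ℕ} {S : Finset ℕ} :
    S ∈ linkedSets n q ↔ IsLinked n S ∧ S.card = q := by
  simp only [linkedSets, Finset.mem_filter, Finset.mem_powersetCard]
  refine ⟨fun h => ⟨h.2, h.1.2⟩, fun h => ⟨⟨fun i hi => ?_, h.2⟩, h.1⟩⟩
  have := h.1.1 i hi
  exact Finset.mem_range.2 (by omega)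

/-- This matches the convention for 0-clusters. -/
theorem isLinked_empty_iff {n : ℕ} (hn : 1 ≤ n) : IsLinked n ∅ ↔ n = 1 := by
  simp only [IsLinked, Finset.notMem_empty, false_and, exists_false, imp_false, not_lt]
  refine ⟨fun h => ?_, fun h => ⟨by simp, fun x => by omega⟩⟩
  have := h.2 0
  omega

theorem numMarked_empty (n : ℕ) : numMarked ∅ n = n.factorial := by
  classical
  rw [← card_forall_occursAt (by simp)]
  simp [Fintype.card_perm]

/-- The places of a function, as a set of numbers. -/
def places {n q : ℕ} (i : Fin q → Fin n) : Finset ℕ := Finset.univ.image fun k => (i k : ℕ)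

theorem mem_places {n q : ℕ} {i : Fin q → Fin n} {x : ℕ} :
    x ∈ places i ↔ ∃ k, (i k : ℕ) = x := by
  simp [places]

theorem card_places {n q : ℕ} {i : Fin q → Fin n} (hi : Function.Injective i) :
    (places i).card = q := by
  exact (Finset.card_image_of_injective _ (Fin.val_injective.comp hi)).trans (by simp)

theorem IsCluster.strictMono {m n q : ℕ} {τ : Equiv.Perm (Fin m)} {σ : Equiv.Perm (Fin n)}
    {i : Fin q → Fin n} (h : IsCluster τ σ i) : StrictMono i := by
  cases q with
  | zero => exact fun a => a.elim0
  | succ q => exact Fin.strictMono_iff_lt_succ.2 fun k => h.increasing _ _ (by simp)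

/-- The pair x, x+1 is covered by the last window starting at or before x: the next window starts
after x but within 3 places, or else this window ends the permutation. -/
theorem IsCluster.isLinked {n q : ℕ} (hq : 1 ≤ q) {σ : Equiv.Perm (Fin n)}
    {i : Fin q → Fin n} (h : IsCluster pattern1324 σ i) : IsLinked n (places i) := by
  have hocc : ∀ k, (i k : ℕ) + 4 ≤ n := fun k => (h.occurs k).1
  refine ⟨fun x hx => ?_, fun x hx => ?_⟩
  · obtain ⟨k, rfl⟩ := mem_places.1 hx
    exact hocc k
  · have hne : (Finset.univ.filter fun k : Fin q => (i k : ℕ) ≤ x).Nonempty := by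
      refine ⟨⟨0, hq⟩, ?_⟩
      simp [h.first ⟨0, hq⟩ rfl]
    obtain ⟨k, hk, hmax⟩ := Finset.exists_max_image _ (fun k : Fin q => (k : ℕ)) hne
    simp only [Finset.mem_filter, Finset.mem_univ, true_and] at hk hmax
    refine ⟨i k, mem_places.2 ⟨k, rfl⟩, hk, ?_⟩
    by_cases hl : (k : ℕ) + 1 = q
    · have := h.last k hl
      omega
    · have h1 := h.linked k ⟨k + 1, by omega⟩ rfl
      have h2 := hmax ⟨k + 1, by omega⟩
      simp only at h2
      omega

/-- Each cluster condition comes from covering one pair: the pair ending where the next occurrence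
starts, the first pair, and the last pair. -/
theorem IsLinked.isCluster {n q : ℕ} (hn : 4 ≤ n) {σ : Equiv.Perm (Fin n)}
    {i : Fin q → Fin n} (hi : StrictMono i) (h : IsLinked n (places i))
    (hocc : ∀ k, OccursAt pattern1324 σ (i k)) : IsCluster pattern1324 σ i := by
  have hcov : ∀ x, x + 1 < n → ∃ k, (i k : ℕ) ≤ x ∧ x ≤ i k + 2 := by
    intro x hx
    obtain ⟨y, hy, h1⟩ := h.2 x hx
    obtain ⟨k, rfl⟩ := mem_places.1 hy
    exact ⟨k, h1⟩
  have hmono : ∀ k l : Fin q, (k : ℕ) ≤ l → (i k : ℕ) ≤ i l := fun k l hkl => hi.monotone hkl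
  have hlt : ∀ k l : Fin q, (k : ℕ) < l → (i k : ℕ) < i l := fun k l hkl => hi hkl
  refine ⟨hocc, fun k l hkl => hi (by simp only [Fin.lt_def]; omega), fun k l hkl => ?_,
    fun k hk => ?_, fun k hk => ?_⟩
  · have h1 := hlt k l (by omega)
    obtain ⟨j, hj1, hj2⟩ := hcov (i l - 1) (by omega)
    have h2 : (j : ℕ) ≤ k := by
      by_contra hjk
      have := hmono l j (by omega)
      omega
    have := hmono j k h2
    omega
  · obtain ⟨j, hj1, hj2⟩ := hcov 0 (by omega)
    have := hmono k j (by omega)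
    omega
  · obtain ⟨j, hj1, hj2⟩ := hcov (n - 2) (by omega)
    have := hmono j k (by omega)
    have : (i k : ℕ) + 4 ≤ n := (hocc k).1
    omega

/-- The clusters, sorted by their sets of marked places. -/
theorem clusterNumber_eq_sum {n : ℕ} (hn : 1 ≤ n) (q : ℕ) :
    clusterNumber pattern1324 n q = ∑ S ∈ linkedSets n q, numMarked S n := by
  classical
  rcases Nat.eq_zero_or_pos q with rfl | hq
  · rw [clusterNumber, if_pos rfl]
    have h0 : ∀ S, S ∈ linkedSets n 0 ↔ S = ∅ ∧ n = 1 := by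
      intro S
      rw [mem_linkedSets, Finset.card_eq_zero]
      constructor
      · rintro ⟨h, rfl⟩
        exact ⟨rfl, (isLinked_empty_iff hn).1 h⟩
      · rintro ⟨rfl, h⟩
        exact ⟨(isLinked_empty_iff hn).2 h, rfl⟩
    split_ifs with h1
    · subst h1
      rw [show linkedSets 1 0 = {∅} by ext S; simp [h0]]
      simp [numMarked_empty]
    · rw [show linkedSets n 0 = ∅ by ext S; simp [h0, h1]]
      simp
  · rw [clusterNumber, if_neg (by omega), Nat.card_eq_fintype_card, Fintype.card_subtype,
      Finset.card_eq_sum_card_fiberwise (f := fun c => places c.2) (t := linkedSets n q)]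
    · refine Finset.sum_congr rfl fun S hS => ?_
      obtain ⟨hS, hcard⟩ := mem_linkedSets.1 hS
      rw [← card_forall_occursAt hS.1]
      refine Finset.card_bij (fun c _ => c.1) ?_ ?_ ?_
      · rintro ⟨σ, i⟩ hc
        simp only [Finset.mem_filter, Finset.mem_univ, true_and] at hc ⊢
        obtain ⟨hc, rfl⟩ := hc
        intro j hj
        obtain ⟨k, hk⟩ := mem_places.1 hj
        rw [← Fin.ext hk]
        exact hc.occurs k
      · rintro ⟨σ, i⟩ hc ⟨σ', i'⟩ hc' h
        simp only [Finset.mem_filter, Finset.mem_univ, true_and] at hc hc' h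
        subst h
        -- A strictly increasing tuple is determined by its set of values.
        have e : ∀ i : Fin q → Fin n, StrictMono i → places i = S →
            (fun k => (i k : ℕ)) = S.orderEmbOfFin hcard := by
          intro i hi hS
          refine Finset.orderEmbOfFin_unique hcard (fun k => ?_) hi
          rw [← hS]
          exact mem_places.2 ⟨k, rfl⟩
        have e' := (e i hc.1.strictMono hc.2).trans (e i' hc'.1.strictMono hc'.2).symm
        have : i = i' := funext fun k => Fin.ext (congrFun e' k)
        rw [this]
      · intro σ hσ
        simp only [Finset.mem_filter, Finset.mem_univ, true_and] at hσ
        have hmem : ∀ k, S.orderEmbOfFin hcard k ∈ S := fun k => Finset.orderEmbOfFin_mem _ _ _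
        have hlt : ∀ k, S.orderEmbOfFin hcard k < n := fun k => by
          have := hS.1 _ (hmem k)
          omega
        let i : Fin q → Fin n := fun k => ⟨S.orderEmbOfFin hcard k, hlt k⟩
        have hp : places i = S := by
          ext x
          rw [mem_places, ← Finset.mem_coe, ← Finset.range_orderEmbOfFin S hcard]
          rfl
        have hn4 : 4 ≤ n := by
          have := hS.1 _ (hmem ⟨0, hq⟩)
          omega
        refine ⟨(σ, i), ?_, rfl⟩
        simp only [Finset.mem_filter, Finset.mem_univ, true_and]
        refine ⟨IsLinked.isCluster hn4 (fun a b hab => ?_) (by rwa [hp]) fun k => hσ _ (hmem k), hp⟩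
        exact (S.orderEmbOfFin hcard).strictMono hab
    · rintro ⟨σ, i⟩ hc
      simp only [Finset.coe_filter, Finset.mem_univ, true_and, Set.mem_ofPred_eq] at hc
      exact mem_linkedSets.2 ⟨hc.isLinked hq, card_places hc.strictMono.injective⟩

theorem clusterNumber_eq_zero_of_lt_four {n : ℕ} (hn : n < 4) {q : ℕ} (hq : 1 ≤ q) :
    clusterNumber pattern1324 n q = 0 := by
  have : IsEmpty {c : Equiv.Perm (Fin n) × (Fin q → Fin n) //
      IsCluster pattern1324 c.1 c.2} := by
    refine ⟨fun ⟨⟨σ, i⟩, hc⟩ => ?_⟩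
    obtain ⟨h, -⟩ := hc.occurs ⟨0, hq⟩
    omega
  rw [clusterNumber, if_neg (by omega)]
  exact Nat.card_of_isEmpty

end Clusters

/-! ### The recurrence for the cluster numbers. -/

section Recurrence

theorem card_evenRun (k : ℕ) : (evenRun k).card = k := by
  rw [show evenRun k = (Finset.range k).image (fun j => 2 * j) by
    ext x
    simp only [mem_evenRun, Finset.mem_image, Finset.mem_range]
    exact ⟨fun h => ⟨x / 2, by omega⟩, fun ⟨j, hj⟩ => by omega⟩,
    Finset.card_image_of_injective _ (fun a b h => by simpa using h), Finset.card_range]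

theorem card_shiftUnion {m : ℕ} {S T : Finset ℕ} (hS : ∀ i ∈ S, i < m) :
    (shiftUnion m S T).card = S.card + T.card := by
  rw [shiftUnion, Finset.card_union_of_disjoint, Finset.card_map]
  rw [Finset.disjoint_left]
  intro x hx hx'
  simp only [Finset.mem_map, addRightEmbedding_apply] at hx'
  obtain ⟨y, -, rfl⟩ := hx'
  have := hS _ hx
  omega

theorem shiftUnion_inj {m : ℕ} {S S' T T' : Finset ℕ} (hS : ∀ i ∈ S, i < m)
    (hS' : ∀ i ∈ S', i < m) (h : shiftUnion m S T = shiftUnion m S' T') : S = S' ∧ T = T' := by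
  have key : ∀ x, (x ∈ S ∨ ∃ y ∈ T, y + m = x) ↔ (x ∈ S' ∨ ∃ y ∈ T', y + m = x) := fun x => by
    rw [← mem_shiftUnion, ← mem_shiftUnion, h]
  have h1 : ∀ {S T : Finset ℕ} {x : ℕ}, x < m → ((x ∈ S ∨ ∃ y ∈ T, y + m = x) ↔ x ∈ S) :=
    fun hx => or_iff_left (by rintro ⟨y, -, rfl⟩; omega)
  have h2 : ∀ {S T : Finset ℕ} {x : ℕ}, (∀ i ∈ S, i < m) →
      ((x + m ∈ S ∨ ∃ y ∈ T, y + m = x + m) ↔ x ∈ T) := by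
    intro S T x hS
    rw [or_iff_right fun h => by have := hS _ h; omega]
    exact ⟨fun ⟨y, hy, h⟩ => by rwa [← Nat.add_right_cancel h], fun h => ⟨x, h, rfl⟩⟩
  constructor
  · ext x
    by_cases hx : x < m
    · rw [← h1 (S := S) (T := T) hx, key, h1 hx]
    · exact ⟨fun h => absurd (hS x h) hx, fun h => absurd (hS' x h) hx⟩
  · ext x
    rw [← h2 (S := S) (T := T) hS, key, h2 hS']

/-- Two occurrences of `1324` cannot start at adjacent places. -/
theorem numMarked_eq_zero {n i : ℕ} {S : Finset ℕ} (hS : ∀ i ∈ S, i + 4 ≤ n) (h0 : i ∈ S)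
    (h1 : i + 1 ∈ S) : numMarked S n = 0 := by
  classical
  have hn := hS _ h1
  rw [← card_forall_occursAt hS, Finset.card_eq_zero, Finset.filter_eq_empty_iff]
  intro σ _ h
  obtain ⟨_, -, h2, -⟩ := (occursAt_pattern1324_iff _ _).1 (h ⟨i, by omega⟩ h0)
  obtain ⟨_, h3, h4, -⟩ := (occursAt_pattern1324_iff _ _).1 (h ⟨i + 1, by omega⟩ h1)
  exact lt_asymm h2 (h3.trans h4)

theorem isLinked_evenRun_shiftUnion {k d : ℕ} (hk : 1 ≤ k) (hd : 1 ≤ d) {T : Finset ℕ}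
    (hT : IsLinked d T) : IsLinked (2 * k + 1 + d) (shiftUnion (2 * k + 1) (evenRun k) T) := by
  simp only [IsLinked, mem_shiftUnion, mem_evenRun]
  constructor
  · rintro i (hi | ⟨j, hj, rfl⟩)
    · omega
    · have := hT.1 j hj
      omega
  · intro x hx
    by_cases hx1 : x < 2 * k + 1
    -- For x = 2k the even start is not marked, and the last window of the run, which reaches 2k+1,
    -- serves instead.
    · refine ⟨min (2 * (x / 2)) (2 * k - 2), Or.inl (by omega), by omega, by omega⟩
    · obtain ⟨i, hi, h⟩ := hT.2 (x - (2 * k + 1)) (by omega)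
      exact ⟨i + (2 * k + 1), Or.inr ⟨i, hi, rfl⟩, by omega, by omega⟩

/-- Take the least k with 2k not in `S`. Odd places below 2k are excluded by adjacency, and the
windows of the run cover no pair beyond (2k, 2k+1), so the remaining places link the tail by
themselves. -/
theorem exists_evenRun_shiftUnion {n : ℕ} (hn : 4 ≤ n) {S : Finset ℕ} (hS : IsLinked n S)
    (hadj : ∀ i ∈ S, i + 1 ∉ S) : ∃ k T, 1 ≤ k ∧ 2 * k + 2 ≤ n ∧
      IsLinked (n - 2 * k - 1) T ∧ shiftUnion (2 * k + 1) (evenRun k) T = S := by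
  have hex : ∃ k, 2 * k ∉ S := ⟨n, fun h => by have := hS.1 _ h; omega⟩
  set k := Nat.find hex with hk
  have hkS : 2 * k ∉ S := Nat.find_spec hex
  have hlt : ∀ j, j < k → 2 * j ∈ S := fun j hj => not_not.1 (Nat.find_min hex hj)
  have hk1 : 1 ≤ k := by
    obtain ⟨i, hi, h1, -⟩ := hS.2 0 (by omega)
    obtain rfl : i = 0 := by omega
    rcases Nat.eq_zero_or_pos k with h | h
    · rw [h] at hkS
      exact absurd hi hkS
    · exact h
  have hnk : 2 * k + 2 ≤ n := by
    have := hS.1 _ (hlt (k - 1) (by omega))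
    omega
  have hrun : ∀ x, x < 2 * k + 1 → (x ∈ S ↔ x < 2 * k ∧ x % 2 = 0) := by
    intro x hx
    constructor
    · intro h
      have h1 : x ≠ 2 * k := fun e => hkS (e ▸ h)
      refine ⟨by omega, ?_⟩
      by_contra h2
      refine hadj _ (hlt (x / 2) (by omega)) ?_
      rwa [show 2 * (x / 2) + 1 = x by omega]
    · rintro ⟨h1, h2⟩
      have := hlt (x / 2) (by omega)
      rwa [show 2 * (x / 2) = x by omega] at this
  have hT : ∀ x, x ∈ (Finset.range n).filter (fun x => x + (2 * k + 1) ∈ S) ↔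
      x + (2 * k + 1) ∈ S := by
    intro x
    rw [Finset.mem_filter, Finset.mem_range, and_iff_right_iff_imp]
    intro h
    have := hS.1 _ h
    omega
  refine ⟨k, (Finset.range n).filter (fun x => x + (2 * k + 1) ∈ S), hk1, hnk, ⟨?_, ?_⟩, ?_⟩
  · intro i hi
    have := hS.1 _ ((hT i).1 hi)
    omega
  · intro x hx
    obtain ⟨i, hi, h1, h2⟩ := hS.2 (x + (2 * k + 1)) (by omega)
    have h3 : 2 * k + 1 ≤ i := by
      by_contra h
      have := (hrun i (by omega)).1 hi
      omega
    refine ⟨i - (2 * k + 1), (hT _).2 ?_, by omega, by omega⟩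
    rwa [Nat.sub_add_cancel h3]
  · ext x
    simp only [mem_shiftUnion, hT, mem_evenRun]
    by_cases hx : x < 2 * k + 1
    · rw [hrun x hx]
      refine or_iff_left ?_
      rintro ⟨y, -, rfl⟩
      omega
    · rw [or_iff_right (by omega)]
      refine ⟨fun ⟨y, hy, h⟩ => h ▸ hy, fun h => ⟨x - (2 * k + 1), ?_, by omega⟩⟩
      rwa [Nat.sub_add_cancel (by omega)]

theorem clusterNumber_recurrence (n l : ℕ) (hn : 4 ≤ n) :
    (clusterNumber pattern1324 n l : ℚ) =
      ∑ k ∈ (Finset.range n).filter (fun k => 4 ≤ 2 * k + 2 ∧ 2 * k + 2 ≤ n ∧ k ≤ l),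
        1 / ((k : ℚ) + 1) * (Nat.choose (2 * k) k : ℚ) *
          (clusterNumber pattern1324 (n - 2 * k - 1) (l - k) : ℚ) := by
  have e : ∀ k ∈ (Finset.range n).filter (fun k => 4 ≤ 2 * k + 2 ∧ 2 * k + 2 ≤ n ∧ k ≤ l),
      1 / ((k : ℚ) + 1) * (Nat.choose (2 * k) k : ℚ) *
          (clusterNumber pattern1324 (n - 2 * k - 1) (l - k) : ℚ) =
        ∑ T ∈ linkedSets (n - 2 * k - 1) (l - k),
          (numMarked (shiftUnion (2 * k + 1) (evenRun k) T) n : ℚ) := by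
    intro k hk
    simp only [Finset.mem_filter, Finset.mem_range] at hk
    rw [clusterNumber_eq_sum (by omega), Nat.cast_sum, Finset.mul_sum]
    refine Finset.sum_congr rfl fun T hT => ?_
    have h := numMarked_evenRun_shiftUnion (k := k) (by omega) (mem_linkedSets.1 hT).1
    rw [show 2 * k + 1 + (n - 2 * k - 1) = n by omega] at h
    rw [h, Nat.cast_mul, numLinExts_evenRun]
  rw [Finset.sum_congr rfl e, Finset.sum_sigma', clusterNumber_eq_sum (by omega), Nat.cast_sum]
  symm
  have hrun : ∀ k, ∀ i ∈ evenRun k, i < 2 * k + 1 := fun k i hi => by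
    rw [mem_evenRun] at hi
    omega
  -- Gluing is injective but not onto: the linked sets it misses contain adjacent places and
  -- contribute zero.
  refine Finset.sum_of_injOn (fun p => shiftUnion (2 * p.1 + 1) (evenRun p.1) p.2) ?_ ?_ ?_ ?_
  · rintro ⟨k, T⟩ - ⟨k', T'⟩ - h
    -- The place 2k is absent after a run of length k but present in any longer run, so k can be
    -- recovered.
    have hex : ∀ {k k' : ℕ} {T T' : Finset ℕ}, shiftUnion (2 * k + 1) (evenRun k) T =
        shiftUnion (2 * k' + 1) (evenRun k') T' → k' ≤ k := by
      intro k k' T T' h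
      by_contra hlt
      have h1 : 2 * k ∈ shiftUnion (2 * k' + 1) (evenRun k') T' :=
        mem_shiftUnion.2 (Or.inl (mem_evenRun.2 (by omega)))
      rw [← h, mem_shiftUnion, mem_evenRun] at h1
      rcases h1 with h1 | ⟨y, -, h1⟩ <;> omega
    obtain rfl : k = k' := le_antisymm (hex h.symm) (hex h)
    obtain rfl : T = T' := (shiftUnion_inj (hrun k) (hrun k) h).2
    rfl
  · rintro ⟨k, T⟩ h
    simp only [Finset.coe_sigma, Set.mem_sigma_iff, Finset.mem_coe, Finset.mem_filter,
      Finset.mem_range, mem_linkedSets] at h ⊢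
    obtain ⟨hk, hT, hc⟩ := h
    have h1 := isLinked_evenRun_shiftUnion (k := k) (by omega) (by omega) hT
    rw [show 2 * k + 1 + (n - 2 * k - 1) = n by omega] at h1
    refine ⟨h1, ?_⟩
    rw [card_shiftUnion (hrun k), card_evenRun, hc]
    omega
  · intro S hS hS'
    obtain ⟨hS, hc⟩ := mem_linkedSets.1 hS
    by_cases hadj : ∀ i ∈ S, i + 1 ∉ S
    · obtain ⟨k, T, hk, hkn, hT, rfl⟩ := exists_evenRun_shiftUnion hn hS hadj
      refine absurd ⟨⟨k, T⟩, ?_, rfl⟩ hS'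
      rw [card_shiftUnion (hrun k), card_evenRun] at hc
      simp only [Finset.coe_sigma, Set.mem_sigma_iff, Finset.mem_coe, Finset.mem_filter,
        Finset.mem_range, mem_linkedSets]
      exact ⟨by omega, hT, by omega⟩
    · push Not at hadj
      obtain ⟨i, h0, h1⟩ := hadj
      rw [numMarked_eq_zero hS.1 h0 h1, Nat.cast_zero]
  · intro p _
    rfl

end Recurrence

/-! ### The generating function for occurrences. -/

section GeneratingFunction

/-- The sets of places where `1324` fits into a permutation of length `n`. -/
def placeSets (n : ℕ) : Finset (Finset ℕ) := (Finset.range (n - 3)).powerset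

theorem mem_placeSets {n : ℕ} {S : Finset ℕ} : S ∈ placeSets n ↔ ∀ i ∈ S, i + 4 ≤ n := by
  simp only [placeSets, Finset.mem_powerset, Finset.subset_iff, Finset.mem_range]
  exact forall₂_congr fun i _ => by omega

variable {R : Type*} [CommSemiring R]

/-- The weighted number of permutations of length `n` with some marked occurrences of `1324`. -/
noncomputable def markedWeight (u : R) (n : ℕ) : R :=
  ∑ S ∈ placeSets n, u ^ S.card * (numMarked S n : R)

open Classical in
/-- The weighted number of clusters of length `n` for `1324`. -/
noncomputable def clusterWeight (u : R) (n : ℕ) : R :=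
  ∑ S ∈ placeSets n with IsLinked n S, u ^ S.card * (numMarked S n : R)

/-- Length 0 must be excluded: there the empty set is linked, but the cluster number is 0. -/
theorem clusterWeight_eq_sum (u : R) {n : ℕ} (hn : 1 ≤ n) :
    clusterWeight u n =
      ∑ l ∈ Finset.range (n + 1), (clusterNumber pattern1324 n l : R) * u ^ l := by
  classical
  rw [clusterWeight, ← Finset.sum_fiberwise_of_maps_to (t := Finset.range (n + 1))
    (g := fun S => S.card)]
  · refine Finset.sum_congr rfl fun l _ => ?_
    rw [clusterNumber_eq_sum hn, Nat.cast_sum, Finset.sum_mul]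
    refine Finset.sum_congr ?_ fun S hS => ?_
    · ext S
      simp only [Finset.mem_filter, mem_linkedSets, mem_placeSets]
      exact ⟨fun h => ⟨h.1.2, h.2⟩, fun h => ⟨⟨h.1.1, h.1⟩, h.2⟩⟩
    · rw [(mem_linkedSets.1 hS).2, mul_comm]
  · intro S hS
    have h1 := Finset.card_le_card (Finset.mem_powerset.1 (Finset.mem_filter.1 hS).1)
    rw [Finset.card_range] at h1
    exact Finset.mem_range.2 (by omega)

/-- Cut at the least m ≥ 1 such that no marked window contains both entries m-1 and m; the end n is
always such a cut. Minimality makes the first part linked. -/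
theorem exists_linked_shiftUnion {n : ℕ} (hn : 1 ≤ n) {U : Finset ℕ} (hU : U ∈ placeSets n) :
    ∃ m S T, 1 ≤ m ∧ m ≤ n ∧ IsLinked m S ∧ T ∈ placeSets (n - m) ∧ shiftUnion m S T = U := by
  rw [mem_placeSets] at hU
  have hex : ∃ m, 1 ≤ m ∧ ∀ i ∈ U, ¬ (i + 1 ≤ m ∧ m ≤ i + 3) :=
    ⟨n, hn, fun i hi h => by have := hU i hi; omega⟩
  set m := Nat.find hex with hm
  obtain ⟨hm1, hcut⟩ := Nat.find_spec hex
  rw [← hm] at hm1 hcut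
  have hmn : m ≤ n := Nat.find_min' hex ⟨hn, fun i hi h => by have := hU i hi; omega⟩
  have hlt : ∀ j, 1 ≤ j → j < m → ∃ i ∈ U, i + 1 ≤ j ∧ j ≤ i + 3 := by
    intro j h1 h2
    by_contra h
    push Not at h
    exact Nat.find_min hex h2 ⟨h1, fun i hi h' => by have := h i hi h'.1; omega⟩
  have hT : ∀ x, x ∈ (Finset.range n).filter (fun x => x + m ∈ U) ↔ x + m ∈ U := by
    intro x
    rw [Finset.mem_filter, Finset.mem_range, and_iff_right_iff_imp]
    intro h
    have := hU _ h
    omega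
  refine ⟨m, U.filter (· < m), (Finset.range n).filter (fun x => x + m ∈ U), hm1, hmn, ⟨?_, ?_⟩,
    ?_, ?_⟩
  · intro i hi
    obtain ⟨hi, him⟩ := Finset.mem_filter.1 hi
    have := hcut i hi
    omega
  · intro x hx
    obtain ⟨i, hi, h1, h2⟩ := hlt (x + 1) (by omega) hx
    exact ⟨i, Finset.mem_filter.2 ⟨hi, by omega⟩, by omega, by omega⟩
  · rw [mem_placeSets]
    intro i hi
    have := hU _ ((hT i).1 hi)
    omega
  · ext x
    simp only [mem_shiftUnion, hT, Finset.mem_filter]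
    by_cases hx : x < m
    · refine ⟨?_, fun h => Or.inl ⟨h, hx⟩⟩
      rintro (h | ⟨y, -, rfl⟩)
      · exact h.1
      · omega
    · rw [or_iff_right fun h => hx h.2]
      refine ⟨fun ⟨y, hy, h⟩ => h ▸ hy, fun h => ⟨x - m, ?_, by omega⟩⟩
      rwa [Nat.sub_add_cancel (by omega)]

/-- A longer first block would need a window across the cut at m, which gives uniqueness of the
decomposition. -/
theorem le_of_shiftUnion_eq {m m' : ℕ} (hm : 1 ≤ m) {S S' T T' : Finset ℕ}
    (hS : ∀ i ∈ S, i + 4 ≤ m) (hS' : IsLinked m' S') (h : shiftUnion m S T = shiftUnion m' S' T') :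
    m' ≤ m := by
  by_contra hlt
  obtain ⟨i, hi, h1, h2⟩ := hS'.2 (m - 1) (by omega)
  have hi' : i ∈ shiftUnion m S T := h ▸ mem_shiftUnion.2 (Or.inl hi)
  rcases mem_shiftUnion.1 hi' with hi' | ⟨y, -, rfl⟩
  · have := hS i hi'
    omega
  · omega

/-- A permutation with marked occurrences splits after its first cluster or unlinked entry. -/
theorem markedWeight_eq_sum (u : R) {n : ℕ} (hn : 1 ≤ n) :
    markedWeight u n = ∑ m ∈ Finset.Icc 1 n,
      (n.choose m : R) * clusterWeight u m * markedWeight u (n - m) := by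
  classical
  have e : ∀ m ∈ Finset.Icc 1 n,
      (n.choose m : R) * clusterWeight u m * markedWeight u (n - m) =
      ∑ p ∈ (placeSets m).filter (IsLinked m) ×ˢ placeSets (n - m),
        u ^ (shiftUnion m p.1 p.2).card * (numMarked (shiftUnion m p.1 p.2) n : R) := by
    intro m hm
    rw [Finset.mem_Icc] at hm
    rw [clusterWeight, markedWeight, mul_assoc, Finset.sum_mul_sum, ← Finset.sum_product',
      Finset.mul_sum]
    refine Finset.sum_congr rfl fun p hp => ?_
    have hS := mem_placeSets.1 (Finset.mem_filter.1 (Finset.mem_product.1 hp).1).1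
    have h := numMarked_shiftUnion (d := n - m) (T := p.2) hS
    rw [show m + (n - m) = n by omega] at h
    rw [h, card_shiftUnion fun i hi => by have := hS i hi; omega, pow_add]
    push_cast
    ring
  rw [Finset.sum_congr rfl e, Finset.sum_sigma']
  symm
  refine Finset.sum_bij (fun p _ => shiftUnion p.1 p.2.1 p.2.2) ?_ ?_ ?_ ?_
  · rintro ⟨m, S, T⟩ h
    simp only [Finset.mem_sigma, Finset.mem_Icc, Finset.mem_product, Finset.mem_filter,
      mem_placeSets, mem_shiftUnion] at h ⊢
    obtain ⟨hm, ⟨hS, -⟩, hT⟩ := h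
    rintro i (hi | ⟨j, hj, rfl⟩)
    · have := hS i hi
      omega
    · have := hT j hj
      omega
  · rintro ⟨m, S, T⟩ h ⟨m', S', T'⟩ h' he
    simp only [Finset.mem_sigma, Finset.mem_Icc, Finset.mem_product, Finset.mem_filter,
      mem_placeSets] at h h' he
    obtain ⟨hm, ⟨hS, hSl⟩, -⟩ := h
    obtain ⟨hm', ⟨hS', hSl'⟩, -⟩ := h'
    obtain rfl : m = m' := le_antisymm (le_of_shiftUnion_eq hm'.1 hS' hSl he.symm)
      (le_of_shiftUnion_eq hm.1 hS hSl' he)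
    obtain ⟨rfl, rfl⟩ := shiftUnion_inj (fun i hi => by have := hS i hi; omega)
      (fun i hi => by have := hS' i hi; omega) he
    rfl
  · intro U hU
    obtain ⟨m, S, T, h1, h2, hS, hT, rfl⟩ := exists_linked_shiftUnion hn hU
    refine ⟨⟨m, S, T⟩, ?_, rfl⟩
    simp only [Finset.mem_sigma, Finset.mem_Icc, Finset.mem_product, Finset.mem_filter]
    exact ⟨⟨h1, h2⟩, ⟨mem_placeSets.2 hS.1, hS⟩, hT⟩
  · intro p _
    rfl

theorem sum_occurrenceNumber {m : ℕ} (τ : Equiv.Perm (Fin m)) (n : ℕ) (t : R) :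
    ∑ k ∈ Finset.range (n + 1), (occurrenceNumber τ n k : R) * t ^ k =
      ∑ σ : Equiv.Perm (Fin n), t ^ occurrenceCount τ σ := by
  classical
  rw [← Finset.sum_fiberwise_of_maps_to (s := Finset.univ) (t := Finset.range (n + 1))
    (g := fun σ : Equiv.Perm (Fin n) => occurrenceCount τ σ)]
  · refine Finset.sum_congr rfl fun k _ => ?_
    rw [occurrenceNumber, Nat.card_eq_fintype_card, Fintype.card_subtype, ← nsmul_eq_mul,
      ← Finset.sum_const]
    exact Finset.sum_congr rfl fun σ hσ => by rw [(Finset.mem_filter.1 hσ).2]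
  · intro σ _
    have h := Set.ncard_le_card {i : Fin n | OccursAt τ σ i}
    rw [Nat.card_eq_fintype_card, Fintype.card_fin] at h
    exact Finset.mem_range.2 (Nat.lt_succ_of_le h)

/-- Marking some of the occurrences replaces the weight `u + 1` of an occurrence by `u`. -/
theorem sum_pow_occurrenceCount (u : R) (n : ℕ) :
    ∑ σ : Equiv.Perm (Fin n), (u + 1) ^ occurrenceCount pattern1324 σ = markedWeight u n := by
  classical
  let O : Equiv.Perm (Fin n) → Finset ℕ := fun σ =>
    (Finset.univ.filter fun i => OccursAt pattern1324 σ i).map Fin.valEmbedding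
  have hO : ∀ σ (i : Fin n), (i : ℕ) ∈ O σ ↔ OccursAt pattern1324 σ i := fun σ i => by
    simp [O, Fin.val_inj]
  have hcard : ∀ σ, occurrenceCount pattern1324 σ = (O σ).card := fun σ => by
    rw [Finset.card_map, occurrenceCount, Set.ncard_eq_toFinset_card', Set.toFinset_ofPred]
  have hfit : ∀ σ, ∀ i ∈ O σ, i + 4 ≤ n := by
    intro σ i hi
    obtain ⟨j, hj, rfl⟩ := Finset.mem_map.1 hi
    exact (Finset.mem_filter.1 hj).2.1
  have hsub : ∀ S ∈ placeSets n, ∀ σ : Equiv.Perm (Fin n),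
      (∀ i : Fin n, (i : ℕ) ∈ S → OccursAt pattern1324 σ i) ↔ S ⊆ O σ := by
    intro S hS σ
    constructor
    · intro h i hi
      have := mem_placeSets.1 hS i hi
      exact (hO σ ⟨i, by omega⟩).2 (h ⟨i, by omega⟩ hi)
    · exact fun h i hi => (hO σ i).1 (h hi)
  have e1 : ∀ σ, (u + 1) ^ occurrenceCount pattern1324 σ =
      ∑ S ∈ placeSets n, if S ⊆ O σ then u ^ S.card else 0 := by
    intro σ
    -- The binomial theorem, as a sum over the subsets of the set of occurrences.
    rw [hcard, ← Finset.sum_pow_mul_eq_add_pow, ← Finset.sum_filter]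
    refine Finset.sum_congr ?_ fun S _ => by rw [one_pow, mul_one]
    ext S
    simp only [Finset.mem_powerset, Finset.mem_filter, mem_placeSets]
    exact ⟨fun h => ⟨fun i hi => hfit σ i (h hi), h⟩, fun h => h.2⟩
  rw [Finset.sum_congr rfl fun σ _ => e1 σ, Finset.sum_comm, markedWeight]
  refine Finset.sum_congr rfl fun S hS => ?_
  rw [← Finset.sum_filter, Finset.sum_const, nsmul_eq_mul, mul_comm,
    ← card_forall_occursAt (mem_placeSets.1 hS)]
  congr 3
  exact Finset.filter_congr fun σ _ => (hsub S hS σ).symm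

theorem markedWeight_zero (u : R) : markedWeight u 0 = 1 := by
  simp [markedWeight, placeSets, numMarked_empty]

/-- A single unlinked entry is the block of length 1; it accounts for the term x of the series. -/
theorem clusterWeight_one (u : R) : clusterWeight u 1 = 1 := by
  rw [clusterWeight_eq_sum u le_rfl, Finset.sum_range_succ, Finset.sum_range_one,
    clusterNumber_eq_zero_of_lt_four (q := 1) (by norm_num) le_rfl]
  simp [clusterNumber]

open Polynomial in
theorem coeff_occurrenceSeries (n : ℕ) :
    PowerSeries.coeff n (occurrenceSeries pattern1324) =
      C (1 / (n.factorial : ℚ)) * markedWeight (X - 1 : ℚ[X]) n := by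
  rw [← sum_pow_occurrenceCount, sub_add_cancel, ← sum_occurrenceNumber, occurrenceSeries,
    PowerSeries.coeff_mk, Finset.mul_sum]
  refine Finset.sum_congr rfl fun k _ => ?_
  rw [div_eq_mul_one_div, C_mul, C_eq_natCast]
  ring

open Polynomial in
theorem coeff_clusterSeries {n : ℕ} (hn : 2 ≤ n) :
    PowerSeries.coeff n (clusterSeries pattern1324) =
      C (1 / (n.factorial : ℚ)) * clusterWeight (X - 1 : ℚ[X]) n := by
  rw [clusterWeight_eq_sum _ (by omega), clusterSeries, PowerSeries.coeff_mk, if_pos hn,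
    Finset.sum_range_eq_add_Ico _ (by omega), clusterNumber, if_pos rfl, if_neg (by omega),
    Nat.cast_zero, zero_mul, zero_add, Finset.mul_sum]
  refine Finset.sum_congr rfl fun l _ => ?_
  rw [div_eq_mul_one_div, C_mul, C_eq_natCast]
  ring

open Polynomial in
theorem coeff_X_add_clusterSeries {n : ℕ} (hn : 1 ≤ n) :
    PowerSeries.coeff n (PowerSeries.X + clusterSeries pattern1324) =
      C (1 / (n.factorial : ℚ)) * clusterWeight (X - 1 : ℚ[X]) n := by
  rw [map_add, PowerSeries.coeff_X]
  rcases Nat.eq_or_lt_of_le hn with rfl | h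
  · simp [clusterWeight_one, clusterSeries]
  · rw [if_neg (by omega), zero_add, coeff_clusterSeries h]

theorem coeff_zero_X_add_clusterSeries :
    PowerSeries.coeff 0 (PowerSeries.X + clusterSeries pattern1324) = 0 := by
  simp [clusterSeries]

/-- `markedWeight_eq_sum` at u = t - 1, read as an identity of exponential generating functions. -/
theorem occurrenceSeries_mul :
    occurrenceSeries pattern1324 * (1 - PowerSeries.X - clusterSeries pattern1324) = 1 := by
  suffices h : occurrenceSeries pattern1324 = 1 +
      (PowerSeries.X + clusterSeries pattern1324) * occurrenceSeries pattern1324 by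
    linear_combination h
  ext1 n
  rw [map_add, PowerSeries.coeff_mul, coeff_occurrenceSeries, PowerSeries.coeff_one]
  rcases Nat.eq_zero_or_pos n with rfl | hn
  · simp [markedWeight_zero, clusterSeries]
  · rw [if_neg (by omega), zero_add, markedWeight_eq_sum _ hn, Finset.mul_sum,
      Finset.Nat.sum_antidiagonal_eq_sum_range_succ_mk, Finset.sum_range_eq_add_Ico _ (by omega),
      coeff_zero_X_add_clusterSeries, zero_mul, zero_add]
    refine Finset.sum_congr rfl fun m hm => ?_
    rw [Finset.mem_Ico, Nat.lt_succ_iff] at hm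
    rw [coeff_X_add_clusterSeries hm.1, coeff_occurrenceSeries]
    -- The binomial of the convolution is absorbed by the factorials.
    have h : (1 / (n.factorial : ℚ)) * (n.choose m : ℚ) =
        (1 / (m.factorial : ℚ)) * (1 / ((n - m).factorial : ℚ)) := by
      rw [Nat.cast_choose ℚ hm.2]
      have := Nat.factorial_ne_zero n
      field_simp
    have h' := congrArg Polynomial.C h
    rw [Polynomial.C_mul, Polynomial.C_mul, Polynomial.C_eq_natCast] at h'
    linear_combination (clusterWeight (Polynomial.X - 1 : Polynomial ℚ) m *
      markedWeight (Polynomial.X - 1 : Polynomial ℚ) (n - m)) * h'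

end GeneratingFunction

end ConsecutivePattern

open ConsecutivePattern in
theorem mainTheorem4 :
    -- the initial conditions
    (∀ l : ℕ, clusterNumber pattern1324 1 l = if l = 0 then 1 else 0) ∧
    (∀ l : ℕ, clusterNumber pattern1324 2 l = 0) ∧
    (∀ l : ℕ, clusterNumber pattern1324 3 l = 0) ∧
    -- the recurrence relation (the terms with `l - k < 0` are zero)
    (∀ n l : ℕ, 4 ≤ n →
      (clusterNumber pattern1324 n l : ℚ) =
        ∑ k ∈ (Finset.range n).filter (fun k => 4 ≤ 2 * k + 2 ∧ 2 * k + 2 ≤ n ∧ k ≤ l),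
          1 / ((k : ℚ) + 1) * (Nat.choose (2 * k) k : ℚ) *
            (clusterNumber pattern1324 (n - 2 * k - 1) (l - k) : ℚ)) ∧
    -- the generating function for occurrences is the inverse of the given series
    occurrenceSeries pattern1324 * (1 - PowerSeries.X - clusterSeries pattern1324) = 1 := by
  -- No window of length 4 fits, so only the convention for l = 0 contributes.
  have h : ∀ n l : ℕ, n < 4 → clusterNumber pattern1324 n l = if l = 0 ∧ n = 1 then 1 else 0 := by
    intro n l hn
    rcases Nat.eq_zero_or_pos l with rfl | hl
    · simp [clusterNumber]
    · rw [clusterNumber_eq_zero_of_lt_four hn hl, if_neg (by omega)]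
  refine ⟨fun l => ?_, fun l => ?_, fun l => ?_, clusterNumber_recurrence, occurrenceSeries_mul⟩
  all_goals
    rw [h _ l (by norm_num)]
    simp
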